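/- **Proposition.** Let $\hat r:[0,\infty)\to\mathbb R$ be concave and non-decreasing with $\hat r(0)=0$, and let $\mu>0$. For a real $p\times n$ matrix $X$ with singular values $\sigma_1(X)\ge\sigma_2(X)\ge\dots\ge 0$ (padded by zeros) put $r(X)=\sum_{i=1}^{p}\hat r(\sigma_i(X))$ and $$\operatorname{Prox}_{\mu r}(X)=\operatorname*{arg\,min}_{W\in\mathbb R^{p\times n}}\ \tfrac12\|W-X\|_F^2+\mu\, r(W),$$ the set of all minimizers (the problem is nonconvex, and there may be several). For $\sigma\ge0$ let $S(\sigma)=\operatorname*{arg\,min}_{y\ge 0}\ \tfrac12(y-\sigma)^2+\mu\hat r(y)$. Let $\gamma\ge 0$, let $Z\in\mathbb R^{m\times n}$ have a singular value decomposition $Z=U\Sigma V^\top$ with singular values in non-increasing order, let $\hat k$ be the number of singular values of $Z$ that are larger than $\gamma$, and let $U_{\hat k}$ consist of the first $\hat k$ columns of $U$. Let $Q\in\mathbb R^{m\times k}$, $k\ge\hat k$, satisfy $Q^\top Q=I$ and $\operatorname{span}(U_{\hat k})\subseteq\operatorname{span}(Q)$ (column spans). 1. Suppose that $\gamma$ is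 a threshold for $\mu\hat r$, i.e. $y=0$ for every $y\in S(\sigma)$ and every $\sigma\in[0,\gamma]$. Then $$\operatorname{Prox}_{\mu r}(Z)=Q\cdot\operatorname{Prox}_{\mu r}(Q^\top Z)=\{QY:\ Y\in\operatorname{Prox}_{\mu r}(Q^\top Z)\}.$$ 2. The same holds for the proximal operator made single-valued by a fixed choice among the scalar minimizers. Let $s:[0,\infty)\to[0,\infty)$ satisfy $s(\sigma)\in S(\sigma)$ for all $\sigma\ge0$ and $s(\sigma)=0$ for all $\sigma\in[0,\gamma]$, and for a matrix $X$ with singular value decomposition $X=U_X\Sigma_XV_X^\top$ let $P_s(X)=U_X\operatorname{Diag}(s(\sigma_1(X)),s(\sigma_2(X)),\dots)V_X^\top$. Then $P_s(Z)$ and $P_s(Q^\top Z)$ do not depend on the chosen decompositions, $P_s(Z)\in\operatorname{Prox}_{\mu r}(Z)$, $P_s(Q^\top Z)\in\operatorname{Prox}_{\mu r}(Q^\top Z)$, and $P_s(Z)=Q\,P_s(Q^\top Z)$. -/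

import Mathlib

open scoped Matrix

namespace LowRankProx

/-- The singular values `σ₀ ≥ σ₁ ≥ … ≥ 0` of a real matrix (padded by zeros). -/
noncomputable def sv {m n : ℕ} (X : Matrix (Fin m) (Fin n) ℝ) (i : ℕ) : ℝ :=
  (Matrix.toEuclideanLin X).singularValues i

/-- The `m × n` matrix with diagonal entries `d 0, d 1, …` and zeros off the diagonal. -/
def rectDiag (m n : ℕ) (d : ℕ → ℝ) : Matrix (Fin m) (Fin n) ℝ :=
  Matrix.of fun i j => if (i : ℕ) = (j : ℕ) then d i else 0

/-- `U`, `V` are the orthogonal factors of a (full) singular value decomposition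
`X = U Σ Vᵀ`, the singular values being in non-increasing order. -/
structure IsSVD {m n : ℕ} (X : Matrix (Fin m) (Fin n) ℝ)
    (U : Matrix (Fin m) (Fin m) ℝ) (V : Matrix (Fin n) (Fin n) ℝ) : Prop where
  left_orthogonal : U ∈ Matrix.orthogonalGroup (Fin m) ℝ
  right_orthogonal : V ∈ Matrix.orthogonalGroup (Fin n) ℝ
  eq_mul : X = U * rectDiag m n (sv X) * Vᵀ

/-- The assumption on the scalar function: concave and non-decreasing on `[0, ∞)`, zero at `0`. -/
structure IsAdmissible (rhat : ℝ → ℝ) : Prop where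
  concave : ConcaveOn ℝ (Set.Ici 0) rhat
  mono : MonotoneOn rhat (Set.Ici 0)
  zero : rhat 0 = 0

/-- The low-rank regularizer `r(X) = ∑_{i = 1}^m rhat (σ_i(X))`. -/
noncomputable def regularizer (rhat : ℝ → ℝ) {m n : ℕ} (X : Matrix (Fin m) (Fin n) ℝ) : ℝ :=
  ∑ i ∈ Finset.range m, rhat (sv X i)

/-- The squared Frobenius norm. -/
def frobSq {m n : ℕ} (X : Matrix (Fin m) (Fin n) ℝ) : ℝ := (Xᵀ * X).trace

/-- The proximal operator `argmin_X ½ ‖X - Z‖_F² + μ r(X)`, as the set of all minimizers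
(the problem is nonconvex, so the minimizer need not be unique). -/
def prox (μ : ℝ) (rhat : ℝ → ℝ) {m n : ℕ} (Z : Matrix (Fin m) (Fin n) ℝ) :
    Set (Matrix (Fin m) (Fin n) ℝ) :=
  {X | IsMinOn (fun W => (1 / 2 : ℝ) * frobSq (W - Z) + μ * regularizer rhat W) Set.univ X}

/-- The solution set of the scalar problem `min_{y ≥ 0} ½ (y - σ)² + μ rhat(y)`. -/
def scalarProx (μ : ℝ) (rhat : ℝ → ℝ) (σ : ℝ) : Set ℝ :=
  {y | 0 ≤ y ∧
    IsMinOn (fun x => (1 / 2 : ℝ) * (x - σ) ^ 2 + μ * rhat x) (Set.Ici 0) y}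

/-- Generalized singular value thresholding by a scalar function `s`: the set of the matrices
`U Diag(s(σ₁), s(σ₂), …) Vᵀ`, for all singular value decompositions `X = U Σ Vᵀ`. -/
def gsvt (s : ℝ → ℝ) {m n : ℕ} (X : Matrix (Fin m) (Fin n) ℝ) :
    Set (Matrix (Fin m) (Fin n) ℝ) :=
  {W | ∃ U V, IsSVD X U V ∧ W = U * rectDiag m n (fun i => s (sv X i)) * Vᵀ}

end LowRankProx

/-!
Write `σᵢ(X)` for the singular values. By von Neumann's trace inequality
`tr(WᵀZ) ≤ ∑ σᵢ(W) σᵢ(Z)`, the matrix objective at `W` is at least the sum of the scalar objectives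
at the pairs `(σᵢ(Z), σᵢ(W))` (`matrixObj_eq`, `sum_scalarObj_le_matrixObj`). Scalar minimizers
depend monotonically on `σ`, so thresholding the singular values of `Z` by scalar minimizers keeps
their order and attains this bound (`gsvt_subset_prox`). Hence at any minimizer `W` the `σᵢ(W)` are
scalar minimizers for `σᵢ(Z)`, and von Neumann's inequality is an equality
(`sv_mem_scalarProx_of_mem_prox`).

*Minimizers as a set.* By the threshold property `W` has rank at most `r`, the number of
singular values of `Z` above `γ`. The trace inequality comes from pairing the singular values
through the doubly substochastic matrix of mean squared overlaps of the singular vectors, and in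
the presence of the gap between `σ_{r-1}(Z)` and `σ_r(Z)` equality forces the overlaps of the left
singular vectors of `W` with those of `Z` below the gap to vanish
(`transpose_mul_eq_zero_of_trace_eq`). So `W = Q Qᵀ W`. On matrices `Q Y` the objective equals, up
to a constant, the compressed objective at `Y` (`matrixObj_mul_of_orthonormal`), and since the
minimum is attained the two sets of minimizers correspond. Concavity enters only here, giving the
lower semicontinuity that makes scalar minimizers exist (`scalarProx_nonempty`).

*Single-valued operator.* If `XᵀX v = t² v`, then `P_s(X) v = (s(t) / t) X v`
(`IsSVD.gsvt_mulVec_of_coord`); as such `v` span, `P_s(X)` does not depend on the decomposition.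
For `P_s(Z) = Q P_s(QᵀZ)` the two sides are compared on eigenvectors of `ZᵀQQᵀZ`
(`mul_gsvt_compress_eq`): above the threshold these are eigenvectors of `ZᵀZ` on which `QQᵀ` acts
trivially, and below it both sides vanish.
-/

namespace LowRankProx

variable {m n k : ℕ}

/-! ### Singular values and the Gram matrix -/

lemma sv_nonneg (X : Matrix (Fin m) (Fin n) ℝ) (i : ℕ) : 0 ≤ sv X i :=
  LinearMap.singularValues_nonneg _ i

lemma sv_antitone (X : Matrix (Fin m) (Fin n) ℝ) : Antitone (sv X) :=
  LinearMap.singularValues_antitone _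

lemma sv_eq_zero_of_cols_le (X : Matrix (Fin m) (Fin n) ℝ) {i : ℕ} (h : n ≤ i) : sv X i = 0 :=
  LinearMap.singularValues_of_finrank_le _ (by simpa using h)

lemma sv_eq_zero_of_rows_le (X : Matrix (Fin m) (Fin n) ℝ) {i : ℕ} (h : m ≤ i) : sv X i = 0 := by
  refine (LinearMap.singularValues_eq_zero_iff_le_finrank_range _).2 (le_trans ?_ h)
  simpa using Submodule.finrank_le (LinearMap.range (Matrix.toEuclideanLin X))

lemma adjoint_comp_self_toEuclideanLin (X : Matrix (Fin m) (Fin n) ℝ) :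
    (Matrix.toEuclideanLin X).adjoint ∘ₗ Matrix.toEuclideanLin X =
      Matrix.toEuclideanLin (Xᵀ * X) := by
  rw [← Matrix.toEuclideanLin_conjTranspose_eq_adjoint,
    Matrix.conjTranspose_eq_transpose_of_trivial]
  ext v i
  simp [Matrix.toLpLin_apply, Matrix.mulVec_mulVec]

lemma charpoly_toEuclideanLin (G : Matrix (Fin n) (Fin n) ℝ) :
    (Matrix.toEuclideanLin G).charpoly = G.charpoly := by
  rw [Matrix.toEuclideanLin_eq_toLin_orthonormal, Matrix.charpoly_toLin]

/-- The singular values are determined by the characteristic polynomial of the Gram matrix. -/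
lemma sv_eq_of_charpoly_gram (X : Matrix (Fin m) (Fin n) ℝ) (d : ℕ → ℝ)
    (hd : Antitone d) (hd0 : ∀ i, 0 ≤ d i) (hdn : ∀ i, n ≤ i → d i = 0)
    (hX : (Xᵀ * X).charpoly =
      (Matrix.diagonal fun i : Fin n => d i ^ 2).charpoly) : sv X = d := by
  funext i
  rcases le_or_gt n i with hi | hi
  · rw [sv_eq_zero_of_cols_le X hi, hdn i hi]
  set T := Matrix.toEuclideanLin X
  have hT := T.isSymmetric_adjoint_comp_self
  have hfr : Module.finrank ℝ (EuclideanSpace ℝ (Fin n)) = n := by simp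
  have hchar : (T.adjoint ∘ₗ T).charpoly =
      (Matrix.diagonal fun i : Fin n => d i ^ 2).charpoly := by
    rw [adjoint_comp_self_toEuclideanLin, charpoly_toEuclideanLin, hX]
  have hroots : (T.adjoint ∘ₗ T).charpoly.roots =
      Multiset.map (fun i : Fin n => d i ^ 2) Finset.univ.val := by
    rw [hchar, Matrix.charpoly_diagonal, Polynomial.roots_prod _ _ (by
      simp only [Finset.prod_ne_zero_iff]
      exact fun i _ => Polynomial.X_sub_C_ne_zero _)]
    simp only [Polynomial.roots_X_sub_C, Multiset.bind_singleton]
  have hsort := hT.sort_roots_charpoly_eq_eigenvalues hfr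
  have hanti : Antitone fun i : Fin n => d i ^ 2 := fun a b hab =>
    pow_le_pow_left₀ (hd0 _) (hd hab) 2
  have hsort' : (Multiset.map RCLike.re ((T.adjoint ∘ₗ T).charpoly.roots)).sort (· ≥ ·) =
      List.ofFn (fun i : Fin n => d i ^ 2) := by
    rw [hroots, Fin.univ_val_map, Multiset.map_coe, List.map_ofFn]
    have : (⇑(RCLike.re : ℝ →+ ℝ) ∘ fun i : Fin n => d i ^ 2) = fun i : Fin n => d i ^ 2 := by
      funext; simp
    rw [this, Multiset.coe_sort]
    apply List.mergeSort_of_pairwise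
    simp_rw [decide_eq_true_eq, ← List.sortedGE_iff_pairwise]
    exact hanti.sortedGE_ofFn
  have heq : hT.eigenvalues hfr = fun i : Fin n => d i ^ 2 :=
    List.ofFn_injective (hsort.symm.trans hsort')
  have := T.singularValues_of_lt hfr hi
  rw [heq] at this
  simpa [sv, Real.sqrt_sq (hd0 i)] using this

/-! ### Rectangular diagonal matrices -/

lemma rectDiag_transpose (d : ℕ → ℝ) : (rectDiag m n d)ᵀ = rectDiag n m d := by
  ext i j
  by_cases h : (i : ℕ) = j
  · simp [rectDiag, h]
  · simp [rectDiag, h, Ne.symm h]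

lemma rectDiag_mul_apply (d : ℕ → ℝ) (N : Matrix (Fin n) (Fin k) ℝ) (i : Fin m) (j : Fin k) :
    (rectDiag m n d * N) i j = if h : (i : ℕ) < n then d i * N ⟨i, h⟩ j else 0 := by
  simp only [Matrix.mul_apply, rectDiag, Matrix.of_apply, ite_mul, zero_mul]
  split_ifs with h
  · rw [Finset.sum_eq_single ⟨i, h⟩] <;> simp +contextual [Fin.ext_iff, eq_comm]
  · refine Finset.sum_eq_zero fun l _ => if_neg fun hl => h ?_
    omega

lemma mul_rectDiag_apply (d : ℕ → ℝ) (N : Matrix (Fin k) (Fin m) ℝ) (i : Fin k) (j : Fin n) :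
    (N * rectDiag m n d) i j = if h : (j : ℕ) < m then N i ⟨j, h⟩ * d j else 0 := by
  rw [← Matrix.transpose_apply (N * _), Matrix.transpose_mul, rectDiag_transpose,
    rectDiag_mul_apply]
  simp [mul_comm]

lemma rectDiag_transpose_mul_rectDiag (d e : ℕ → ℝ) (hd : ∀ i, m ≤ i → d i = 0) :
    (rectDiag m n d)ᵀ * rectDiag m n e = Matrix.diagonal fun i : Fin n => d i * e i := by
  ext i j
  rw [rectDiag_transpose, rectDiag_mul_apply]
  by_cases h : (i : ℕ) < m
  · by_cases hij : i = j
    · subst hij; simp [h, rectDiag]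
    · simp [rectDiag, hij, Fin.ext_iff.not.1 hij]
  · by_cases hij : i = j
    · subst hij; simp [h, hd _ (not_lt.1 h)]
    · simp [h, hij]

/-! ### Singular value decompositions -/

lemma sv_eq_of_gram_eq {X : Matrix (Fin m) (Fin n) ℝ} {Y : Matrix (Fin k) (Fin n) ℝ}
    (h : Xᵀ * X = Yᵀ * Y) : sv X = sv Y := by
  have hT := (Matrix.toEuclideanLin X).isSymmetric_adjoint_comp_self
  have hT' := (Matrix.toEuclideanLin Y).isSymmetric_adjoint_comp_self
  have hfr : Module.finrank ℝ (EuclideanSpace ℝ (Fin n)) = n := by simp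
  have heq : hT.eigenvalues hfr = hT'.eigenvalues hfr := by
    rw [hT.eigenvalues_eq_eigenvalues_iff, adjoint_comp_self_toEuclideanLin,
      adjoint_comp_self_toEuclideanLin, h]
  funext i
  rcases le_or_gt n i with hi | hi
  · rw [sv_eq_zero_of_cols_le X hi, sv_eq_zero_of_cols_le Y hi]
  · simp only [sv]
    rw [LinearMap.singularValues_of_lt _ hfr hi, LinearMap.singularValues_of_lt _ hfr hi, heq]

/-- A product `U Diag(d) Vᵀ` with orthogonal factors and a non-increasing nonnegative diagonal has
the singular values `d`. -/
lemma sv_mul_rectDiag_mul {U : Matrix (Fin m) (Fin m) ℝ} {V : Matrix (Fin n) (Fin n) ℝ}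
    (hU : U ∈ Matrix.orthogonalGroup (Fin m) ℝ) (hV : V ∈ Matrix.orthogonalGroup (Fin n) ℝ)
    {d : ℕ → ℝ} (hd : Antitone d) (hd0 : ∀ i, 0 ≤ d i) (hdm : ∀ i, m ≤ i → d i = 0)
    (hdn : ∀ i, n ≤ i → d i = 0) : sv (U * rectDiag m n d * Vᵀ) = d := by
  have hU' : Uᵀ * U = 1 := (Matrix.mem_orthogonalGroup_iff' _ _).1 hU
  have hV' : Vᵀ * V = 1 := (Matrix.mem_orthogonalGroup_iff' _ _).1 hV
  have hV'' : V * Vᵀ = 1 := (Matrix.mem_orthogonalGroup_iff _ _).1 hV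
  refine sv_eq_of_charpoly_gram _ d hd hd0 hdn ?_
  have hgram : (U * rectDiag m n d * Vᵀ)ᵀ * (U * rectDiag m n d * Vᵀ) =
      V * (Matrix.diagonal (fun i : Fin n => d i ^ 2) * Vᵀ) := by
    have h := rectDiag_transpose_mul_rectDiag (m := m) (n := n) d d hdm
    simp only [← pow_two] at h
    rw [← h]
    simp only [Matrix.transpose_mul, Matrix.transpose_transpose, Matrix.mul_assoc]
    rw [← Matrix.mul_assoc Uᵀ, hU', Matrix.one_mul]
  rw [hgram, Matrix.charpoly_mul_comm, Matrix.mul_assoc, hV', Matrix.mul_one]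

lemma _root_.OrthonormalBasis.matrix_mem_orthogonalGroup
    (v : OrthonormalBasis (Fin n) ℝ (EuclideanSpace ℝ (Fin n))) :
    (Matrix.of fun i j => v j i) ∈ Matrix.orthogonalGroup (Fin n) ℝ := by
  rw [Matrix.mem_orthogonalGroup_iff']
  ext i j
  have := orthonormal_iff_ite.1 v.orthonormal i j
  simp only [PiLp.inner_apply, RCLike.inner_apply, conj_trivial] at this
  simp only [Matrix.mul_apply, Matrix.transpose_apply, Matrix.of_apply, Matrix.one_apply]
  rw [← this]
  exact Finset.sum_congr rfl fun _ _ => mul_comm _ _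

/-- Every real matrix has a singular value decomposition: take an orthonormal eigenbasis `v` of
`XᵀX`, and extend the orthonormal family `X vᵢ / σᵢ`, `σᵢ > 0`, to a basis. -/
lemma exists_isSVD (X : Matrix (Fin m) (Fin n) ℝ) : ∃ U V, IsSVD X U V := by
  set T := Matrix.toEuclideanLin X with hTdef
  have hT := T.isSymmetric_adjoint_comp_self
  have hfr : Module.finrank ℝ (EuclideanSpace ℝ (Fin n)) = n := by simp
  set v := hT.eigenvectorBasis hfr with hv
  have hsq (i : Fin n) : hT.eigenvalues hfr i = sv X i ^ 2 :=
    (T.sq_singularValues_fin hfr i).symm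
  have hinner (i j : Fin n) : inner ℝ (T (v i)) (T (v j)) = if i = j then sv X j ^ 2 else 0 := by
    rw [← LinearMap.adjoint_inner_right, ← LinearMap.comp_apply, hT.apply_eigenvectorBasis hfr,
      hsq, inner_smul_right, ← hv, orthonormal_iff_ite.1 v.orthonormal]
    simp
  set w : Fin m → EuclideanSpace ℝ (Fin m) :=
    fun i => if h : (i : ℕ) < n then (sv X i)⁻¹ • T (v ⟨i, h⟩) else 0 with hw
  set s : Set (Fin m) := {i | (i : ℕ) < n ∧ sv X i ≠ 0} with hs
  have hws : Orthonormal ℝ (s.domRestrict w) := by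
    rw [orthonormal_iff_ite]
    rintro ⟨i, hi, hi0⟩ ⟨j, hj, hj0⟩
    simp only [Set.domRestrict_apply, hw, hi, hj, dif_pos, inner_smul_left, inner_smul_right,
      hinner, Subtype.mk.injEq, Fin.mk.injEq, ← Fin.ext_iff]
    by_cases hij : i = j
    · subst hij
      simp
      field_simp
    · simp [hij]
  obtain ⟨u, hu⟩ := hws.exists_orthonormalBasis_extension_of_card_eq (by simp)
  set U : Matrix (Fin m) (Fin m) ℝ := Matrix.of fun i j => u j i with hU
  set V : Matrix (Fin n) (Fin n) ℝ := Matrix.of fun i j => v j i with hV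
  have hUo : U ∈ Matrix.orthogonalGroup (Fin m) ℝ := u.matrix_mem_orthogonalGroup
  have hVo : V ∈ Matrix.orthogonalGroup (Fin n) ℝ := v.matrix_mem_orthogonalGroup
  refine ⟨U, V, hUo, hVo, ?_⟩
  have hV'' : V * Vᵀ = 1 := (Matrix.mem_orthogonalGroup_iff _ _).1 hVo
  have key : X * V = U * rectDiag m n (sv X) := by
    ext i j
    have hXV : (X * V) i j = T (v j) i := rfl
    rw [hXV, mul_rectDiag_apply]
    by_cases h0 : sv X j = 0
    · have : T (v j) = 0 := by
        rw [← inner_self_eq_zero (𝕜 := ℝ), hinner]; simp [h0]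
      simp [this, h0]
    · have hjm : (j : ℕ) < m := by
        by_contra hc
        exact h0 (sv_eq_zero_of_rows_le X (not_lt.1 hc))
      have := hu ⟨j, hjm⟩ ⟨j.2, h0⟩
      simp only [hjm, dif_pos, hU, Matrix.of_apply, this, hw, j.2]
      simp
      field_simp
  rw [← key, Matrix.mul_assoc, hV'', Matrix.mul_one]

/-! ### Substochastic couplings of sorted sequences -/

/-- Abel summation: domination of the partial sums is preserved by non-increasing nonnegative
weights. -/
lemma sum_mul_le_sum_mul_of_partial_sums_le {a x y : ℕ → ℝ} (ha : Antitone a) (ha0 : ∀ i, 0 ≤ a i)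
    {m : ℕ} (h : ∀ k ≤ m, ∑ i ∈ Finset.range k, x i ≤ ∑ i ∈ Finset.range k, y i) :
    ∑ i ∈ Finset.range m, a i * x i ≤ ∑ i ∈ Finset.range m, a i * y i := by
  -- The weighted excess is at least the unweighted one times the last weight.
  have key : ∀ k ≤ m, a k * (∑ i ∈ Finset.range k, y i - ∑ i ∈ Finset.range k, x i) ≤
      ∑ i ∈ Finset.range k, a i * y i - ∑ i ∈ Finset.range k, a i * x i := by
    intro k
    induction k with
    | zero => simp
    | succ k ih =>
      intro hk
      have h1 := ih (by omega)
      have h2 := h (k + 1) hk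
      have h3 : a (k + 1) * (∑ i ∈ Finset.range (k + 1), y i - ∑ i ∈ Finset.range (k + 1), x i) ≤
          a k * (∑ i ∈ Finset.range (k + 1), y i - ∑ i ∈ Finset.range (k + 1), x i) :=
        mul_le_mul_of_nonneg_right (ha k.le_succ) (by linarith)
      refine h3.trans ?_
      simp only [Finset.sum_range_succ]
      linarith
  have := key m le_rfl
  have h2 := mul_nonneg (ha0 m) (sub_nonneg.2 (h m le_rfl))
  linarith

/-- Weights in `[0, 1]` of total mass at most `k` collect at most the `k` largest terms. -/
lemma sum_mul_le_sum_range {b c : ℕ → ℝ} (hb : Antitone b) (hb0 : ∀ i, 0 ≤ b i)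
    (hc0 : ∀ j, 0 ≤ c j) (hc1 : ∀ j, c j ≤ 1) {m k : ℕ} (hk : k ≤ m)
    (hc : ∑ j ∈ Finset.range m, c j ≤ k) :
    ∑ j ∈ Finset.range m, b j * c j ≤ ∑ j ∈ Finset.range k, b j := by
  -- Measure `b` from the level `b k`: then larger weights help for `j < k` only.
  have h1 : ∀ j ∈ Finset.range m, (b j - b k) * c j ≤ if j < k then b j - b k else 0 := by
    intro j _
    split_ifs with h
    · exact mul_le_of_le_one_right (sub_nonneg.2 (hb h.le)) (hc1 j)
    · exact mul_nonpos_of_nonpos_of_nonneg (sub_nonpos.2 (hb (not_lt.1 h))) (hc0 j)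
  have h2 := Finset.sum_le_sum h1
  rw [← Finset.sum_filter] at h2
  have h3 : (Finset.range m).filter (fun j => j < k) = Finset.range k := by
    ext j; simp; omega
  rw [h3] at h2
  simp only [sub_mul, Finset.sum_sub_distrib, ← Finset.mul_sum, Finset.sum_const,
    Finset.card_range, nsmul_eq_mul] at h2
  nlinarith [mul_le_mul_of_nonneg_left hc (hb0 k)]

/-- Sorted nonnegative sequences pair best along the diagonal among all doubly substochastic
couplings. -/
lemma sum_mul_substochastic_le_range {m : ℕ} {a b : ℕ → ℝ} (ha : Antitone a) (ha0 : ∀ i, 0 ≤ a i)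
    (hb : Antitone b) (hb0 : ∀ i, 0 ≤ b i) {D : ℕ → ℕ → ℝ} (hD : ∀ i j, 0 ≤ D i j)
    (hrow : ∀ i < m, ∑ j ∈ Finset.range m, D i j ≤ 1)
    (hcol : ∀ j, ∑ i ∈ Finset.range m, D i j ≤ 1) :
    ∑ i ∈ Finset.range m, ∑ j ∈ Finset.range m, a i * b j * D i j ≤
      ∑ i ∈ Finset.range m, a i * b i := by
  have := sum_mul_le_sum_mul_of_partial_sums_le (m := m) ha ha0
    (x := fun i => ∑ j ∈ Finset.range m, b j * D i j) (y := b) (by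
      intro k hk
      rw [Finset.sum_comm]
      simp only [← Finset.mul_sum]
      refine sum_mul_le_sum_range hb hb0 (fun j => Finset.sum_nonneg fun i _ => hD i j)
        (fun j => ?_) hk ?_
      · exact (Finset.sum_le_sum_of_subset_of_nonneg (Finset.range_mono hk)
          fun i _ _ => hD i j).trans (hcol j)
      · rw [Finset.sum_comm]
        refine (Finset.sum_le_sum fun i hi => hrow i ?_).trans (by simp)
        have := Finset.mem_range.1 hi
        omega)
  simpa only [Finset.mul_sum, mul_assoc] using this

lemma sum_mul_substochastic_le {m : ℕ} {a b : ℕ → ℝ} (ha : Antitone a) (ha0 : ∀ i, 0 ≤ a i)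
    (hb : Antitone b) (hb0 : ∀ i, 0 ≤ b i) {D : Fin m → Fin m → ℝ} (hD : ∀ i j, 0 ≤ D i j)
    (hrow : ∀ i, ∑ j, D i j ≤ 1) (hcol : ∀ j, ∑ i, D i j ≤ 1) :
    ∑ i : Fin m, ∑ j : Fin m, a i * b j * D i j ≤ ∑ i ∈ Finset.range m, a i * b i := by
  set D' : ℕ → ℕ → ℝ := fun i j => if h : i < m ∧ j < m then D ⟨i, h.1⟩ ⟨j, h.2⟩ else 0 with hD'
  have := sum_mul_substochastic_le_range (m := m) ha ha0 hb hb0 (D := D') ?_ ?_ ?_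
  · simpa [Finset.sum_range, hD'] using this
  · intro i j
    simp only [hD']
    split_ifs
    exacts [hD _ _, le_rfl]
  · intro i hi
    simpa [Finset.sum_range, hD', hi] using hrow ⟨i, hi⟩
  · intro j
    by_cases hj : j < m
    · simpa [Finset.sum_range, hD', hj] using hcol ⟨j, hj⟩
    · simp [hD', hj]

/-- Equality for a sequence `a` that vanishes from `k` on, against a sequence `b` with a gap at `k`:
the coupling then puts no mass between the support of `a` and the indices past the gap. -/
lemma eq_zero_of_sum_mul_substochastic_eq {m k : ℕ} {a b : ℕ → ℝ} (ha : Antitone a)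
    (ha0 : ∀ i, 0 ≤ a i) (hb : Antitone b) (hb0 : ∀ i, 0 ≤ b i) (hak : ∀ i, k ≤ i → a i = 0)
    (hbk : ∀ i j, i < k → k ≤ j → b j < b i)
    {D : Fin m → Fin m → ℝ} (hD : ∀ i j, 0 ≤ D i j)
    (hrow : ∀ i, ∑ j, D i j ≤ 1) (hcol : ∀ j, ∑ i, D i j ≤ 1)
    (h : ∑ i ∈ Finset.range m, a i * b i ≤ ∑ i : Fin m, ∑ j : Fin m, a i * b j * D i j)
    {i j : Fin m} (hi : a i ≠ 0) (hj : k ≤ j) : D i j = 0 := by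
  -- Raising the tail of `b` to the level `b (k - 1)` does not change `∑ a i * b i`.
  set b' : ℕ → ℝ := fun j => b (min j (k - 1)) with hb'
  have hbb' (j : ℕ) : b j ≤ b' j := hb (min_le_left _ _)
  have h1 := sum_mul_substochastic_le ha ha0 (b := b')
    (fun x y hxy => hb (min_le_min_right _ hxy)) (fun _ => hb0 _) hD hrow hcol
  have h2 : ∑ i ∈ Finset.range m, a i * b' i = ∑ i ∈ Finset.range m, a i * b i := by
    refine Finset.sum_congr rfl fun i _ => ?_
    rcases le_or_gt k i with hki | hki
    · simp [hak i hki]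
    · simp only [hb']
      rw [min_eq_left (by omega)]
  have hnn (i j : Fin m) : a i * b j * D i j ≤ a i * b' j * D i j :=
    mul_le_mul_of_nonneg_right (mul_le_mul_of_nonneg_left (hbb' _) (ha0 _)) (hD i j)
  have heq : ∑ i : Fin m, ∑ j : Fin m, a i * b j * D i j =
      ∑ i : Fin m, ∑ j : Fin m, a i * b' j * D i j :=
    le_antisymm (Finset.sum_le_sum fun i _ => Finset.sum_le_sum fun j _ => hnn i j) (by linarith)
  have h3 := (Finset.sum_eq_sum_iff_of_le fun i _ => Finset.sum_le_sum fun j _ => hnn i j).1 heq i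
    (Finset.mem_univ _)
  have h4 := (Finset.sum_eq_sum_iff_of_le fun j _ => hnn i j).1 h3 j (Finset.mem_univ _)
  have hik : (i : ℕ) < k := by
    by_contra hc
    exact hi (hak i (not_lt.1 hc))
  have hlt : b j < b' j := by
    simp only [hb']
    rw [min_eq_right (by omega)]
    exact hbk _ _ (by omega) hj
  have h5 : a i * (b' j - b j) * D i j = 0 := by linarith
  simpa [hi, (sub_pos.2 hlt).ne'] using h5

/-! ### Von Neumann's trace inequality -/

/-- Both sides sum `F` over the diagonal of an `m × n` array. -/
lemma sum_fin_dite_comm (F : Fin m → Fin n → ℝ) :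
    ∑ j : Fin n, (if h : (j : ℕ) < m then F ⟨j, h⟩ j else 0) =
      ∑ i : Fin m, (if h : (i : ℕ) < n then F i ⟨i, h⟩ else 0) := by
  have h1 (j : Fin n) : (if h : (j : ℕ) < m then F ⟨j, h⟩ j else 0) =
      ∑ i : Fin m, if (i : ℕ) = j then F i j else 0 := by
    split_ifs with h
    · rw [Finset.sum_eq_single ⟨j, h⟩] <;> simp +contextual [Fin.ext_iff]
    · refine (Finset.sum_eq_zero fun i _ => if_neg fun hi => h ?_).symm
      omega
  have h2 (i : Fin m) : (if h : (i : ℕ) < n then F i ⟨i, h⟩ else 0) =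
      ∑ j : Fin n, if (i : ℕ) = j then F i j else 0 := by
    split_ifs with h
    · rw [Finset.sum_eq_single ⟨i, h⟩] <;> simp +contextual [Fin.ext_iff, eq_comm]
    · refine (Finset.sum_eq_zero fun j _ => if_neg fun hj => h ?_).symm
      omega
  simp only [h1, h2]
  exact Finset.sum_comm

lemma sum_fin_dite_le {f : Fin n → ℝ} (hf : ∀ j, 0 ≤ f j) :
    ∑ i : Fin m, (if h : (i : ℕ) < n then f ⟨i, h⟩ else 0) ≤ ∑ j, f j := by
  rw [← sum_fin_dite_comm fun _ => f]
  refine Finset.sum_le_sum fun j _ => ?_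
  split_ifs
  exacts [le_rfl, hf j]

/-- The square of size `m` cut out of (or padded with zeros from) a square matrix of size `n`. -/
def resize (m : ℕ) (R : Matrix (Fin n) (Fin n) ℝ) : Matrix (Fin m) (Fin m) ℝ :=
  Matrix.of fun i j => if hi : (i : ℕ) < n then if hj : (j : ℕ) < n then R ⟨i, hi⟩ ⟨j, hj⟩ else 0
    else 0

lemma sum_sq_row_of_orthogonal {R : Matrix (Fin n) (Fin n) ℝ}
    (hR : R ∈ Matrix.orthogonalGroup (Fin n) ℝ) (i : Fin n) : ∑ j, R i j ^ 2 = 1 := by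
  have := congr_fun₂ ((Matrix.mem_orthogonalGroup_iff _ _).1 hR) i i
  simpa [Matrix.mul_apply, ← pow_two] using this

lemma transpose_mem_orthogonalGroup {R : Matrix (Fin n) (Fin n) ℝ}
    (hR : R ∈ Matrix.orthogonalGroup (Fin n) ℝ) : Rᵀ ∈ Matrix.orthogonalGroup (Fin n) ℝ := by
  rw [Matrix.mem_orthogonalGroup_iff, Matrix.transpose_transpose]
  exact (Matrix.mem_orthogonalGroup_iff' _ _).1 hR

lemma resize_transpose (R : Matrix (Fin n) (Fin n) ℝ) : resize m Rᵀ = (resize m R)ᵀ := by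
  ext i j
  simp only [resize, Matrix.of_apply, Matrix.transpose_apply]
  split_ifs <;> rfl

lemma sum_sq_row_resize_le {R : Matrix (Fin n) (Fin n) ℝ}
    (hR : R ∈ Matrix.orthogonalGroup (Fin n) ℝ) (i : Fin m) : ∑ j, resize m R i j ^ 2 ≤ 1 := by
  by_cases hi : (i : ℕ) < n
  · refine le_trans (le_of_eq ?_) ((sum_fin_dite_le (m := m) (f := fun j => R ⟨i, hi⟩ j ^ 2)
      fun j => sq_nonneg _).trans (sum_sq_row_of_orthogonal hR _).le)
    refine Finset.sum_congr rfl fun j _ => ?_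
    simp only [resize, Matrix.of_apply, hi, dif_pos]
    split_ifs <;> simp
  · simp [resize, hi]

/-- The doubly substochastic matrix that two orthogonal matrices define, the entrywise mean of
their squares. -/
noncomputable def coupling (P : Matrix (Fin m) (Fin m) ℝ) (R : Matrix (Fin n) (Fin n) ℝ)
    (i j : Fin m) : ℝ := (P i j ^ 2 + resize m R i j ^ 2) / 2

lemma coupling_nonneg (P : Matrix (Fin m) (Fin m) ℝ) (R : Matrix (Fin n) (Fin n) ℝ)
    (i j : Fin m) : 0 ≤ coupling P R i j := by
  unfold coupling; positivity

lemma sum_row_coupling_le {P : Matrix (Fin m) (Fin m) ℝ} {R : Matrix (Fin n) (Fin n) ℝ}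
    (hP : P ∈ Matrix.orthogonalGroup (Fin m) ℝ) (hR : R ∈ Matrix.orthogonalGroup (Fin n) ℝ)
    (i : Fin m) : ∑ j, coupling P R i j ≤ 1 := by
  simp only [coupling, ← Finset.sum_div, Finset.sum_add_distrib]
  linarith [sum_sq_row_of_orthogonal hP i, sum_sq_row_resize_le hR i]

lemma sum_col_coupling_le {P : Matrix (Fin m) (Fin m) ℝ} {R : Matrix (Fin n) (Fin n) ℝ}
    (hP : P ∈ Matrix.orthogonalGroup (Fin m) ℝ) (hR : R ∈ Matrix.orthogonalGroup (Fin n) ℝ)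
    (j : Fin m) : ∑ i, coupling P R i j ≤ 1 := by
  have := sum_row_coupling_le (transpose_mem_orthogonalGroup hP)
    (transpose_mem_orthogonalGroup hR) j
  simpa [coupling, resize_transpose] using this

/-- The Frobenius inner product of two matrices in factored form, in terms of the overlaps of
their factors. -/
lemma trace_mul_rectDiag_mul (U U' : Matrix (Fin m) (Fin m) ℝ) (V V' : Matrix (Fin n) (Fin n) ℝ)
    (a b : ℕ → ℝ) :
    ((U * rectDiag m n a * Vᵀ)ᵀ * (U' * rectDiag m n b * V'ᵀ)).trace =
      ∑ i : Fin m, ∑ j : Fin m, a i * b j * ((Uᵀ * U') i j * resize m (Vᵀ * V') i j) := by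
  have h1 : ((U * rectDiag m n a * Vᵀ)ᵀ * (U' * rectDiag m n b * V'ᵀ)).trace =
      ((Uᵀ * U' * rectDiag m n b) * (rectDiag m n a * (Vᵀ * V'))ᵀ).trace := by
    simp only [Matrix.transpose_mul, Matrix.transpose_transpose, Matrix.mul_assoc]
    rw [Matrix.trace_mul_comm]
    simp only [Matrix.mul_assoc]
    rw [Matrix.trace_mul_comm]
    simp only [Matrix.mul_assoc]
  rw [h1, Matrix.trace]
  refine Finset.sum_congr rfl fun i _ => ?_
  simp only [Matrix.diag_apply, Matrix.mul_apply (M := Uᵀ * U' * rectDiag m n b),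
    Matrix.transpose_apply (rectDiag m n a * (Vᵀ * V')), mul_rectDiag_apply, rectDiag_mul_apply]
  by_cases hi : (i : ℕ) < n
  · have := sum_fin_dite_comm (m := m) (n := n)
      fun j q => (Uᵀ * U') i j * b j * (a i * (Vᵀ * V') ⟨i, hi⟩ q)
    simp only [hi, dif_pos, dite_mul, zero_mul]
    refine this.trans (Finset.sum_congr rfl fun j _ => ?_)
    simp only [resize, Matrix.of_apply, hi, dif_pos]
    split_ifs
    · ring
    · simp
  · simp [resize, hi]

lemma transpose_mul_mem_orthogonalGroup {R S : Matrix (Fin n) (Fin n) ℝ}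
    (hR : R ∈ Matrix.orthogonalGroup (Fin n) ℝ) (hS : S ∈ Matrix.orthogonalGroup (Fin n) ℝ) :
    Rᵀ * S ∈ Matrix.orthogonalGroup (Fin n) ℝ :=
  mul_mem (transpose_mem_orthogonalGroup hR) hS

lemma trace_le_sum_coupling {W Z : Matrix (Fin m) (Fin n) ℝ}
    {U U' : Matrix (Fin m) (Fin m) ℝ} {V V' : Matrix (Fin n) (Fin n) ℝ}
    (hW : IsSVD W U V) (hZ : IsSVD Z U' V') :
    (Wᵀ * Z).trace ≤
      ∑ i : Fin m, ∑ j : Fin m, sv W i * sv Z j * coupling (Uᵀ * U') (Vᵀ * V') i j := by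
  have h := trace_mul_rectDiag_mul U U' V V' (sv W) (sv Z)
  rw [← hW.eq_mul, ← hZ.eq_mul] at h
  rw [h]
  refine Finset.sum_le_sum fun i _ => Finset.sum_le_sum fun j _ =>
    mul_le_mul_of_nonneg_left ?_ (mul_nonneg (sv_nonneg _ _) (sv_nonneg _ _))
  unfold coupling
  nlinarith [sq_nonneg ((Uᵀ * U') i j - resize m (Vᵀ * V') i j)]

/-- Von Neumann's trace inequality: in singular bases the trace is a sum of products
`P i j * R i j` of overlaps, which is bounded by the coupling of mean squares. -/
lemma trace_le_sum_sv_mul_sv (W Z : Matrix (Fin m) (Fin n) ℝ) :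
    (Wᵀ * Z).trace ≤ ∑ i ∈ Finset.range m, sv W i * sv Z i := by
  obtain ⟨U, V, hW⟩ := exists_isSVD W
  obtain ⟨U', V', hZ⟩ := exists_isSVD Z
  have hP := transpose_mul_mem_orthogonalGroup hW.left_orthogonal hZ.left_orthogonal
  have hR := transpose_mul_mem_orthogonalGroup hW.right_orthogonal hZ.right_orthogonal
  exact (trace_le_sum_coupling hW hZ).trans (sum_mul_substochastic_le (sv_antitone W) (sv_nonneg W)
    (sv_antitone Z) (sv_nonneg Z) (coupling_nonneg _ _) (sum_row_coupling_le hP hR)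
    (sum_col_coupling_le hP hR))

/-- Equality in von Neumann's trace inequality, when `W` has rank at most `r` and `Z` has a gap
after its first `r` singular values: the columns of `W` are orthogonal to the left singular vectors
of `Z` past the gap. -/
lemma transpose_mul_eq_zero_of_trace_eq {W Z : Matrix (Fin m) (Fin n) ℝ}
    {U : Matrix (Fin m) (Fin m) ℝ} {V : Matrix (Fin n) (Fin n) ℝ} (hZ : IsSVD Z U V) {r : ℕ}
    (hWr : ∀ i, r ≤ i → sv W i = 0) (hZr : ∀ i j, i < r → r ≤ j → sv Z j < sv Z i)
    (h : ∑ i ∈ Finset.range m, sv W i * sv Z i ≤ (Wᵀ * Z).trace) {j : Fin m} (hj : r ≤ j)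
    (q : Fin n) : (Uᵀ * W) j q = 0 := by
  obtain ⟨U', V', hW⟩ := exists_isSVD W
  have hP := transpose_mul_mem_orthogonalGroup hW.left_orthogonal hZ.left_orthogonal
  have hR := transpose_mul_mem_orthogonalGroup hW.right_orthogonal hZ.right_orthogonal
  have hzero (i : Fin m) (hi : sv W i ≠ 0) : (Uᵀ * U') j i = 0 := by
    have := eq_zero_of_sum_mul_substochastic_eq (sv_antitone W) (sv_nonneg W)
      (sv_antitone Z) (sv_nonneg Z) hWr hZr (coupling_nonneg _ _) (sum_row_coupling_le hP hR)
      (sum_col_coupling_le hP hR) (h.trans (trace_le_sum_coupling hW hZ)) hi hj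
    unfold coupling at this
    -- The left overlaps enter the coupling at full size `m`, whatever `n` is.
    have h0 : (U'ᵀ * U) i j = 0 := by
      nlinarith [sq_nonneg ((U'ᵀ * U) i j), sq_nonneg (resize m (V'ᵀ * V) i j)]
    rw [← h0, ← Matrix.transpose_apply (U'ᵀ * U), Matrix.transpose_mul, Matrix.transpose_transpose]
  have hcol : (Uᵀ * U' * rectDiag m n (sv W)) j = 0 := by
    funext p
    rw [mul_rectDiag_apply]
    split_ifs with hp
    · by_cases h0 : sv W p = 0
      · simp [h0]
      · simp [hzero ⟨p, hp⟩ h0]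
    · rfl
  have hWeq : Uᵀ * W = Uᵀ * U' * rectDiag m n (sv W) * V'ᵀ := by
    conv_lhs => rw [hW.eq_mul]
    simp only [Matrix.mul_assoc]
  rw [hWeq, Matrix.mul_apply, hcol]
  simp

/-! ### The Frobenius norm -/

lemma frobSq_mul_rectDiag_mul {U : Matrix (Fin m) (Fin m) ℝ} {V : Matrix (Fin n) (Fin n) ℝ}
    (hU : U ∈ Matrix.orthogonalGroup (Fin m) ℝ) (hV : V ∈ Matrix.orthogonalGroup (Fin n) ℝ)
    {d : ℕ → ℝ} (hdn : ∀ i, n ≤ i → d i = 0) :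
    frobSq (U * rectDiag m n d * Vᵀ) = ∑ i ∈ Finset.range m, d i ^ 2 := by
  have hU' : Uᵀ * U = 1 := (Matrix.mem_orthogonalGroup_iff' _ _).1 hU
  have hV' : Vᵀ * V = 1 := (Matrix.mem_orthogonalGroup_iff' _ _).1 hV
  rw [frobSq, trace_mul_rectDiag_mul, hU', hV', Finset.sum_range]
  refine Finset.sum_congr rfl fun i _ => ?_
  rw [Finset.sum_eq_single i (fun j _ hj => by simp [Matrix.one_apply_ne hj.symm]) (by simp)]
  by_cases hi : (i : ℕ) < n
  · simp [resize, hi]; ring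
  · simp [hdn _ (not_lt.1 hi)]

lemma frobSq_eq_sum_sv (X : Matrix (Fin m) (Fin n) ℝ) :
    frobSq X = ∑ i ∈ Finset.range m, sv X i ^ 2 := by
  obtain ⟨U, V, h⟩ := exists_isSVD X
  rw [← frobSq_mul_rectDiag_mul h.left_orthogonal h.right_orthogonal
    fun i hi => sv_eq_zero_of_cols_le X hi, ← h.eq_mul]

lemma frobSq_sub (W Z : Matrix (Fin m) (Fin n) ℝ) :
    frobSq (W - Z) = frobSq W - 2 * (Wᵀ * Z).trace + frobSq Z := by
  have h : (Zᵀ * W).trace = (Wᵀ * Z).trace := by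
    rw [← Matrix.trace_transpose, Matrix.transpose_mul, Matrix.transpose_transpose]
  simp only [frobSq, Matrix.transpose_sub, Matrix.sub_mul, Matrix.mul_sub, Matrix.trace_sub, h]
  ring

/-! ### The scalar proximal problem -/

/-- The objective of the scalar proximal problem. -/
noncomputable def scalarObj (μ : ℝ) (rhat : ℝ → ℝ) (σ y : ℝ) : ℝ :=
  (1 / 2 : ℝ) * (y - σ) ^ 2 + μ * rhat y

/-- The objective of the matrix proximal problem. -/
noncomputable def matrixObj (μ : ℝ) (rhat : ℝ → ℝ) (Z W : Matrix (Fin m) (Fin n) ℝ) : ℝ :=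
  (1 / 2 : ℝ) * frobSq (W - Z) + μ * regularizer rhat W

lemma mem_scalarProx_iff {μ : ℝ} {rhat : ℝ → ℝ} {σ y : ℝ} :
    y ∈ scalarProx μ rhat σ ↔
      0 ≤ y ∧ ∀ x, 0 ≤ x → scalarObj μ rhat σ y ≤ scalarObj μ rhat σ x := Iff.rfl

lemma mem_prox_iff {μ : ℝ} {rhat : ℝ → ℝ} {Z X : Matrix (Fin m) (Fin n) ℝ} :
    X ∈ prox μ rhat Z ↔ ∀ W, matrixObj μ rhat Z X ≤ matrixObj μ rhat Z W := by
  simp [prox, isMinOn_iff, matrixObj]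

/-- A concave function can jump on `[0, ∞)` only at `0`, and there monotonicity makes the jump go
upwards. -/
lemma IsAdmissible.lowerSemicontinuousOn {rhat : ℝ → ℝ} (hr : IsAdmissible rhat) :
    LowerSemicontinuousOn rhat (Set.Ici 0) := by
  intro x hx y hy
  rcases eq_or_lt_of_le (Set.mem_Ici.1 hx) with h0 | h0
  · subst h0
    filter_upwards [self_mem_nhdsWithin] with z hz
    exact hy.trans_le (hr.mono (Set.mem_Ici.2 le_rfl) hz hz)
  · have hc := hr.concave.continuousOn_interior
    rw [interior_Ici] at hc
    have hc' : ContinuousAt rhat x := hc.continuousAt (Ioi_mem_nhds h0)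
    exact (hc'.tendsto.eventually (lt_mem_nhds hy)).filter_mono nhdsWithin_le_nhds

/-- A minimizer is sought on `[0, σ]`, which is compact. -/
lemma scalarProx_nonempty {rhat : ℝ → ℝ} (hr : IsAdmissible rhat) {μ : ℝ} (hμ : 0 < μ) {σ : ℝ}
    (hσ : 0 ≤ σ) : (scalarProx μ rhat σ).Nonempty := by
  have hlsc : LowerSemicontinuousOn (scalarObj μ rhat σ) (Set.Icc 0 σ) := by
    refine LowerSemicontinuousOn.add ?_ ?_
    · exact (by fun_prop : Continuous fun y : ℝ => (1 / 2 : ℝ) * (y - σ) ^ 2).lowerSemicontinuous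
        |>.lowerSemicontinuousOn _
    · intro x hx y hy
      have := hr.lowerSemicontinuousOn.mono Set.Icc_subset_Ici_self x hx (y / μ)
        ((div_lt_iff₀' hμ).2 hy)
      filter_upwards [this] with z hz
      exact (div_lt_iff₀' hμ).1 hz
  obtain ⟨y, hy, hmin⟩ := hlsc.exists_isMinOn ⟨0, Set.left_mem_Icc.2 hσ⟩ isCompact_Icc
  refine ⟨y, mem_scalarProx_iff.2 ⟨hy.1, fun x hx => ?_⟩⟩
  rcases le_or_gt x σ with h | h
  · exact hmin ⟨hx, h⟩
  · -- beyond `σ` both terms of the objective are larger than at `σ`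
    refine (hmin ⟨hσ, le_rfl⟩ : scalarObj μ rhat σ y ≤ scalarObj μ rhat σ σ).trans ?_
    have h1 := mul_le_mul_of_nonneg_left (hr.mono (Set.mem_Ici.2 hσ) (Set.mem_Ici.2 hx) h.le) hμ.le
    unfold scalarObj
    nlinarith [sq_nonneg (x - σ)]

/-- Scalar minimizers are non-decreasing in `σ`: add the two minimality inequalities. -/
lemma scalarProx_mono {μ : ℝ} {rhat : ℝ → ℝ} {σ τ y z : ℝ} (h : σ < τ)
    (hy : y ∈ scalarProx μ rhat σ) (hz : z ∈ scalarProx μ rhat τ) : y ≤ z := by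
  rw [mem_scalarProx_iff] at hy hz
  have h1 := hy.2 z hz.1
  have h2 := hz.2 y hy.1
  unfold scalarObj at h1 h2
  by_contra hc
  nlinarith [mul_pos (sub_pos.2 h) (sub_pos.2 (not_le.1 hc))]

lemma antitone_comp_sv {μ : ℝ} {rhat s : ℝ → ℝ}
    (hs : ∀ σ, 0 ≤ σ → s σ ∈ scalarProx μ rhat σ) (Z : Matrix (Fin m) (Fin n) ℝ) :
    Antitone fun i => s (sv Z i) := by
  intro i j hij
  rcases (sv_antitone Z hij).eq_or_lt with h | h
  · exact (congrArg s h).le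
  · exact scalarProx_mono h (hs _ (sv_nonneg _ _)) (hs _ (sv_nonneg _ _))

/-! ### The matrix proximal problem -/

/-- The matrix objective is the sum of the scalar objectives at the singular values plus the
defect in von Neumann's trace inequality. -/
lemma matrixObj_eq {μ : ℝ} {rhat : ℝ → ℝ} (Z W : Matrix (Fin m) (Fin n) ℝ) :
    matrixObj μ rhat Z W = ∑ i ∈ Finset.range m, scalarObj μ rhat (sv Z i) (sv W i) +
      (∑ i ∈ Finset.range m, sv W i * sv Z i - (Wᵀ * Z).trace) := by
  have h1 (i : ℕ) : scalarObj μ rhat (sv Z i) (sv W i) =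
      (1 / 2) * sv W i ^ 2 - sv W i * sv Z i + (1 / 2) * sv Z i ^ 2 + μ * rhat (sv W i) := by
    unfold scalarObj; ring
  rw [matrixObj, frobSq_sub, frobSq_eq_sum_sv W, frobSq_eq_sum_sv Z]
  simp only [regularizer, h1, Finset.sum_add_distrib, Finset.sum_sub_distrib, ← Finset.mul_sum]
  ring

lemma sum_scalarObj_le_matrixObj {μ : ℝ} {rhat : ℝ → ℝ} (Z W : Matrix (Fin m) (Fin n) ℝ) :
    ∑ i ∈ Finset.range m, scalarObj μ rhat (sv Z i) (sv W i) ≤ matrixObj μ rhat Z W := by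
  rw [matrixObj_eq]
  linarith [trace_le_sum_sv_mul_sv W Z]

lemma matrixObj_gsvt {μ : ℝ} {rhat s : ℝ → ℝ} (hs : ∀ σ, 0 ≤ σ → s σ ∈ scalarProx μ rhat σ)
    (hs0 : s 0 = 0) {Z : Matrix (Fin m) (Fin n) ℝ} {U : Matrix (Fin m) (Fin m) ℝ}
    {V : Matrix (Fin n) (Fin n) ℝ} (hZ : IsSVD Z U V) :
    matrixObj μ rhat Z (U * rectDiag m n (fun i => s (sv Z i)) * Vᵀ) =
      ∑ i ∈ Finset.range m, scalarObj μ rhat (sv Z i) (s (sv Z i)) := by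
  have hsv : sv (U * rectDiag m n (fun i => s (sv Z i)) * Vᵀ) = fun i => s (sv Z i) :=
    sv_mul_rectDiag_mul hZ.left_orthogonal hZ.right_orthogonal (antitone_comp_sv hs Z)
      (fun i => (hs _ (sv_nonneg _ _)).1) (fun i hi => by rw [sv_eq_zero_of_rows_le Z hi, hs0])
      (fun i hi => by rw [sv_eq_zero_of_cols_le Z hi, hs0])
  have hsub : U * rectDiag m n (fun i => s (sv Z i)) * Vᵀ - Z =
      U * rectDiag m n (fun i => s (sv Z i) - sv Z i) * Vᵀ := by
    have hd : rectDiag m n (fun i => s (sv Z i) - sv Z i) =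
        rectDiag m n (fun i => s (sv Z i)) - rectDiag m n (sv Z) := by
      ext i j
      simp only [rectDiag, Matrix.of_apply, Matrix.sub_apply]
      split_ifs <;> simp
    rw [hd, Matrix.mul_sub, Matrix.sub_mul, ← hZ.eq_mul]
  rw [matrixObj, hsub, frobSq_mul_rectDiag_mul hZ.left_orthogonal hZ.right_orthogonal
    (fun i hi => by rw [sv_eq_zero_of_cols_le Z hi, hs0, sub_self]), regularizer, hsv]
  simp only [scalarObj, Finset.sum_add_distrib, Finset.mul_sum]

/-- Thresholding the singular values by scalar minimizers gives a matrix minimizer. -/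
lemma gsvt_subset_prox {μ : ℝ} {rhat s : ℝ → ℝ} (hs : ∀ σ, 0 ≤ σ → s σ ∈ scalarProx μ rhat σ)
    (hs0 : s 0 = 0) (Z : Matrix (Fin m) (Fin n) ℝ) : gsvt s Z ⊆ prox μ rhat Z := by
  rintro _ ⟨U, V, hZ, rfl⟩
  refine mem_prox_iff.2 fun W => ?_
  rw [matrixObj_gsvt hs hs0 hZ]
  exact (Finset.sum_le_sum fun i _ => (mem_scalarProx_iff.1 (hs _ (sv_nonneg Z i))).2 _
    (sv_nonneg W i)).trans (sum_scalarObj_le_matrixObj Z W)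

/-- At a matrix minimizer the singular values are scalar minimizers, and von Neumann's inequality
is an equality. -/
lemma sv_mem_scalarProx_of_mem_prox {μ : ℝ} {rhat s : ℝ → ℝ}
    (hs : ∀ σ, 0 ≤ σ → s σ ∈ scalarProx μ rhat σ) (hs0 : s 0 = 0)
    {Z W : Matrix (Fin m) (Fin n) ℝ} (hW : W ∈ prox μ rhat Z) :
    (∀ i < m, sv W i ∈ scalarProx μ rhat (sv Z i)) ∧
      ∑ i ∈ Finset.range m, sv W i * sv Z i ≤ (Wᵀ * Z).trace := by
  obtain ⟨U, V, hZ⟩ := exists_isSVD Z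
  have h1 := mem_prox_iff.1 hW (U * rectDiag m n (fun i => s (sv Z i)) * Vᵀ)
  rw [matrixObj_gsvt hs hs0 hZ] at h1
  have hle (i : ℕ) (_ : i ∈ Finset.range m) :
      scalarObj μ rhat (sv Z i) (s (sv Z i)) ≤ scalarObj μ rhat (sv Z i) (sv W i) :=
    (mem_scalarProx_iff.1 (hs _ (sv_nonneg Z i))).2 _ (sv_nonneg W i)
  have h2 := Finset.sum_le_sum hle
  have h3 := sum_scalarObj_le_matrixObj (μ := μ) (rhat := rhat) Z W
  constructor
  · intro i hi
    have heq := (Finset.sum_eq_sum_iff_of_le hle).1 (by linarith) i (Finset.mem_range.2 hi)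
    refine mem_scalarProx_iff.2 ⟨sv_nonneg W i, fun x hx => ?_⟩
    rw [← heq]
    exact (mem_scalarProx_iff.1 (hs _ (sv_nonneg Z i))).2 x hx
  · rw [matrixObj_eq] at h1
    linarith

/-! ### Compression by a matrix with orthonormal columns -/

lemma sv_mul_of_orthonormal {Q : Matrix (Fin m) (Fin k) ℝ} (hQ : Qᵀ * Q = 1)
    (Y : Matrix (Fin k) (Fin n) ℝ) : sv (Q * Y) = sv Y := by
  apply sv_eq_of_gram_eq
  rw [Matrix.transpose_mul, Matrix.mul_assoc, ← Matrix.mul_assoc Qᵀ, hQ, Matrix.one_mul]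

lemma le_of_orthonormal {Q : Matrix (Fin m) (Fin k) ℝ} (hQ : Qᵀ * Q = 1) : k ≤ m := by
  have h := Matrix.rank_mul_le_left Qᵀ Q
  rw [hQ, Matrix.rank_one] at h
  simpa using h.trans (Matrix.rank_le_width _)

lemma regularizer_mul_of_orthonormal {rhat : ℝ → ℝ} (h0 : rhat 0 = 0)
    {Q : Matrix (Fin m) (Fin k) ℝ} (hQ : Qᵀ * Q = 1) (Y : Matrix (Fin k) (Fin n) ℝ) :
    regularizer rhat (Q * Y) = regularizer rhat Y := by
  unfold regularizer
  rw [sv_mul_of_orthonormal hQ]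
  refine (Finset.sum_subset (Finset.range_mono (le_of_orthonormal hQ)) fun i _ hi => ?_).symm
  rw [sv_eq_zero_of_rows_le Y (by simpa using hi), h0]

/-- On matrices of the form `Q Y` the objective differs by a constant from the one of the
compressed problem. -/
lemma matrixObj_mul_of_orthonormal {μ : ℝ} {rhat : ℝ → ℝ} (h0 : rhat 0 = 0)
    {Q : Matrix (Fin m) (Fin k) ℝ} (hQ : Qᵀ * Q = 1) (Z : Matrix (Fin m) (Fin n) ℝ)
    (Y : Matrix (Fin k) (Fin n) ℝ) :
    matrixObj μ rhat Z (Q * Y) = matrixObj μ rhat (Qᵀ * Z) Y +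
      (1 / 2) * (frobSq Z - frobSq (Qᵀ * Z)) := by
  have h1 : frobSq (Q * Y) = frobSq Y := by
    rw [frobSq, frobSq, Matrix.transpose_mul, Matrix.mul_assoc, ← Matrix.mul_assoc Qᵀ, hQ,
      Matrix.one_mul]
  have h2 : (Q * Y)ᵀ * Z = Yᵀ * (Qᵀ * Z) := by rw [Matrix.transpose_mul, Matrix.mul_assoc]
  simp only [matrixObj, frobSq_sub, regularizer_mul_of_orthonormal h0 hQ, h1, h2]
  ring

/-! ### Independence of the decomposition -/

lemma rectDiag_mulVec_apply (d : ℕ → ℝ) (w : Fin n → ℝ) (i : Fin m) :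
    (rectDiag m n d *ᵥ w) i = if h : (i : ℕ) < n then d i * w ⟨i, h⟩ else 0 := by
  have := rectDiag_mul_apply (m := m) d (Matrix.of fun j (_ : Fin 1) => w j) i 0
  simpa [Matrix.mul_apply, Matrix.mulVec, dotProduct] using this

lemma IsSVD.gram_eq {X : Matrix (Fin m) (Fin n) ℝ} {U : Matrix (Fin m) (Fin m) ℝ}
    {V : Matrix (Fin n) (Fin n) ℝ} (hX : IsSVD X U V) :
    Vᵀ * (Xᵀ * X) = Matrix.diagonal (fun i : Fin n => sv X i ^ 2) * Vᵀ := by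
  have hU' : Uᵀ * U = 1 := (Matrix.mem_orthogonalGroup_iff' _ _).1 hX.left_orthogonal
  have hV' : Vᵀ * V = 1 := (Matrix.mem_orthogonalGroup_iff' _ _).1 hX.right_orthogonal
  have hB := rectDiag_transpose_mul_rectDiag (n := n) (sv X) (sv X)
    fun i hi => sv_eq_zero_of_rows_le X hi
  simp only [← pow_two] at hB
  have h : Xᵀ * X = V * (rectDiag m n (sv X))ᵀ * (rectDiag m n (sv X) * Vᵀ) := by
    conv_lhs => rw [hX.eq_mul]
    simp only [Matrix.transpose_mul, Matrix.transpose_transpose, Matrix.mul_assoc]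
    rw [← Matrix.mul_assoc Uᵀ, hU', Matrix.one_mul]
  rw [h, ← hB]
  simp only [Matrix.mul_assoc]
  rw [← Matrix.mul_assoc Vᵀ, hV', Matrix.one_mul]

lemma IsSVD.gram_mulVec_col {X : Matrix (Fin m) (Fin n) ℝ} {U : Matrix (Fin m) (Fin m) ℝ}
    {V : Matrix (Fin n) (Fin n) ℝ} (hX : IsSVD X U V) (j : Fin n) :
    (Xᵀ * X) *ᵥ V.col j = sv X j ^ 2 • V.col j := by
  have h := congrArg Matrix.transpose hX.gram_eq
  simp only [Matrix.transpose_mul, Matrix.transpose_transpose, Matrix.diagonal_transpose] at h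
  funext i
  have := congr_fun₂ h i j
  rw [Matrix.mul_diagonal] at this
  simpa [Matrix.mul_apply, Matrix.mulVec, dotProduct, mul_comm] using this

/-- The coordinates of an eigenvector of `XᵀX` for `t²` in a basis of right singular vectors
vanish except where the singular value is `t`. -/
lemma IsSVD.coord_eq_zero_or {X : Matrix (Fin m) (Fin n) ℝ} {U : Matrix (Fin m) (Fin m) ℝ}
    {V : Matrix (Fin n) (Fin n) ℝ} (hX : IsSVD X U V) {v : Fin n → ℝ} {t : ℝ} (ht : 0 ≤ t)
    (hv : (Xᵀ * X) *ᵥ v = t ^ 2 • v) (i : Fin n) : (Vᵀ *ᵥ v) i = 0 ∨ sv X i = t := by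
  have h : (Vᵀ * (Xᵀ * X)) *ᵥ v = t ^ 2 • (Vᵀ *ᵥ v) := by
    rw [← Matrix.mulVec_mulVec, hv, Matrix.mulVec_smul]
  rw [hX.gram_eq, ← Matrix.mulVec_mulVec] at h
  have hi := congr_fun h i
  rw [Matrix.mulVec_diagonal, Pi.smul_apply, smul_eq_mul] at hi
  by_cases h0 : (Vᵀ *ᵥ v) i = 0
  · exact Or.inl h0
  · exact Or.inr ((pow_left_inj₀ (sv_nonneg _ _) ht two_ne_zero).1 (mul_right_cancel₀ h0 hi))

/-- If the coordinates of `v` vanish except where the singular value is `t`, then `U Diag(s) Vᵀ`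
acts on `v` as a multiple of `X`. For `t = 0` the junk value `s 0 / 0 = 0` is the right one. -/
lemma IsSVD.gsvt_mulVec_of_coord {X : Matrix (Fin m) (Fin n) ℝ} {U : Matrix (Fin m) (Fin m) ℝ}
    {V : Matrix (Fin n) (Fin n) ℝ} (hX : IsSVD X U V) {s : ℝ → ℝ} (hs0 : s 0 = 0) {v : Fin n → ℝ}
    {t : ℝ} (hv : ∀ i, (Vᵀ *ᵥ v) i = 0 ∨ sv X i = t) :
    (U * rectDiag m n (fun i => s (sv X i)) * Vᵀ) *ᵥ v = (s t / t) • (X *ᵥ v) := by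
  conv_rhs => rw [hX.eq_mul]
  simp only [← Matrix.mulVec_mulVec]
  rw [← Matrix.mulVec_smul]
  congr 1
  funext i
  rw [Pi.smul_apply, rectDiag_mulVec_apply, rectDiag_mulVec_apply]
  split_ifs with h
  · rcases hv ⟨i, h⟩ with h0 | h0
    · simp [h0]
    · simp only at h0
      rw [h0, smul_eq_mul]
      by_cases ht : t = 0
      · simp [ht, hs0]
      · field_simp
  · simp

lemma ext_of_mulVec_col {V : Matrix (Fin n) (Fin n) ℝ} (hV : V ∈ Matrix.orthogonalGroup (Fin n) ℝ)
    {A B : Matrix (Fin m) (Fin n) ℝ} (h : ∀ j, A *ᵥ V.col j = B *ᵥ V.col j) : A = B := by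
  have hAB : A * V = B * V := by
    ext i j
    exact congr_fun (h j) i
  have hV' : V * Vᵀ = 1 := (Matrix.mem_orthogonalGroup_iff _ _).1 hV
  rw [← Matrix.mul_one A, ← Matrix.mul_one B, ← hV', ← Matrix.mul_assoc, hAB, Matrix.mul_assoc]

/-- The columns of one right factor are eigenvectors of the Gram matrix, and on those the action
of the thresholded matrix does not involve the decomposition. -/
lemma gsvt_eq_singleton {X : Matrix (Fin m) (Fin n) ℝ} {U : Matrix (Fin m) (Fin m) ℝ}
    {V : Matrix (Fin n) (Fin n) ℝ} (hX : IsSVD X U V) {s : ℝ → ℝ} (hs0 : s 0 = 0) :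
    gsvt s X = {U * rectDiag m n (fun i => s (sv X i)) * Vᵀ} := by
  refine Set.eq_singleton_iff_unique_mem.2 ⟨⟨U, V, hX, rfl⟩, ?_⟩
  rintro _ ⟨U', V', hX', rfl⟩
  refine ext_of_mulVec_col hX.right_orthogonal fun j => ?_
  have h := hX.gram_mulVec_col j
  rw [hX.gsvt_mulVec_of_coord hs0 (hX.coord_eq_zero_or (sv_nonneg _ _) h),
    hX'.gsvt_mulVec_of_coord hs0 (hX'.coord_eq_zero_or (sv_nonneg _ _) h)]

/-! ### Thresholding and compression -/

lemma mul_transpose_mulVec_of_mem_span {Q : Matrix (Fin m) (Fin k) ℝ} (hQ : Qᵀ * Q = 1)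
    {u : Fin m → ℝ} (hu : u ∈ Submodule.span ℝ (Set.range Q.col)) : (Q * Qᵀ) *ᵥ u = u := by
  rw [← Matrix.range_mulVecLin] at hu
  obtain ⟨x, rfl⟩ := hu
  rw [Matrix.mulVecLin_apply, Matrix.mulVec_mulVec, Matrix.mul_assoc, hQ, Matrix.mul_one]

lemma dotProduct_mulVec_gram (X : Matrix (Fin m) (Fin n) ℝ) (v w : Fin n → ℝ) :
    (X *ᵥ v) ⬝ᵥ (X *ᵥ w) = v ⬝ᵥ ((Xᵀ * X) *ᵥ w) := by
  rw [← Matrix.mulVec_mulVec, Matrix.dotProduct_mulVec v, Matrix.vecMul_transpose]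

lemma dotProduct_transpose_mulVec_le {Q : Matrix (Fin m) (Fin k) ℝ} (hQ : Qᵀ * Q = 1)
    (z : Fin m → ℝ) : (Qᵀ *ᵥ z) ⬝ᵥ (Qᵀ *ᵥ z) ≤ z ⬝ᵥ z := by
  have h1 : ((Q * Qᵀ) *ᵥ z) ⬝ᵥ z = (Qᵀ *ᵥ z) ⬝ᵥ (Qᵀ *ᵥ z) := by
    rw [← Matrix.mulVec_mulVec, Matrix.dotProduct_mulVec, Matrix.vecMul_transpose]
  have h2 : ((Q * Qᵀ) *ᵥ z) ⬝ᵥ ((Q * Qᵀ) *ᵥ z) = (Qᵀ *ᵥ z) ⬝ᵥ (Qᵀ *ᵥ z) := by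
    rw [← Matrix.mulVec_mulVec, dotProduct_mulVec_gram, hQ, Matrix.one_mulVec]
  have h3 : 0 ≤ (z - (Q * Qᵀ) *ᵥ z) ⬝ᵥ (z - (Q * Qᵀ) *ᵥ z) :=
    Finset.sum_nonneg fun i _ => mul_self_nonneg _
  rw [sub_dotProduct, dotProduct_sub, dotProduct_sub, h2, h1,
    dotProduct_comm z ((Q * Qᵀ) *ᵥ z), h1] at h3
  linarith

lemma dotProduct_mulVec_of_orthogonal {V : Matrix (Fin n) (Fin n) ℝ}
    (hV : V ∈ Matrix.orthogonalGroup (Fin n) ℝ) (v w : Fin n → ℝ) :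
    (Vᵀ *ᵥ v) ⬝ᵥ (Vᵀ *ᵥ w) = v ⬝ᵥ w := by
  have hV' : V * Vᵀ = 1 := (Matrix.mem_orthogonalGroup_iff _ _).1 hV
  rw [Matrix.dotProduct_mulVec, Matrix.vecMul_transpose, Matrix.mulVec_mulVec, hV',
    Matrix.one_mulVec]

lemma IsSVD.gram_quadratic {X : Matrix (Fin m) (Fin n) ℝ} {U : Matrix (Fin m) (Fin m) ℝ}
    {V : Matrix (Fin n) (Fin n) ℝ} (hX : IsSVD X U V) (v : Fin n → ℝ) :
    (X *ᵥ v) ⬝ᵥ (X *ᵥ v) = ∑ i : Fin n, sv X i ^ 2 * (Vᵀ *ᵥ v) i ^ 2 := by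
  rw [dotProduct_mulVec_gram, ← dotProduct_mulVec_of_orthogonal hX.right_orthogonal,
    Matrix.mulVec_mulVec, hX.gram_eq, ← Matrix.mulVec_mulVec]
  simp only [dotProduct, Matrix.mulVec_diagonal]
  exact Finset.sum_congr rfl fun i _ => by ring

/-- Compression by `Q` commutes with thresholding the singular values, if the range of `Q` contains
the left singular vectors with singular values above the threshold. -/
lemma mul_gsvt_compress_eq {Z : Matrix (Fin m) (Fin n) ℝ} {U : Matrix (Fin m) (Fin m) ℝ}
    {V : Matrix (Fin n) (Fin n) ℝ} (hZ : IsSVD Z U V) {Q : Matrix (Fin m) (Fin k) ℝ}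
    (hQ : Qᵀ * Q = 1) {U' : Matrix (Fin k) (Fin k) ℝ} {V' : Matrix (Fin n) (Fin n) ℝ}
    (hQZ : IsSVD (Qᵀ * Z) U' V') {s : ℝ → ℝ} {γ : ℝ} (hγ : 0 ≤ γ)
    (hs : ∀ σ, 0 ≤ σ → σ ≤ γ → s σ = 0)
    (hspan : ∀ j : Fin m, γ < sv Z j → (Q * Qᵀ) *ᵥ U.col j = U.col j) :
    Q * (U' * rectDiag k n (fun i => s (sv (Qᵀ * Z) i)) * V'ᵀ) =
      U * rectDiag m n (fun i => s (sv Z i)) * Vᵀ := by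
  have hs0 : s 0 = 0 := hs 0 le_rfl hγ
  have hVV : Vᵀ * V = 1 := (Matrix.mem_orthogonalGroup_iff' _ _).1 hZ.right_orthogonal
  have hVV' : V * Vᵀ = 1 := (Matrix.mem_orthogonalGroup_iff _ _).1 hZ.right_orthogonal
  -- `Q Qᵀ` fixes the images of the right singular vectors above the threshold.
  have hfix (p : Fin n) (hp : γ < sv Z p) : (Q * Qᵀ) *ᵥ (Z *ᵥ V.col p) = Z *ᵥ V.col p := by
    have hpm : (p : ℕ) < m := by
      by_contra hc
      rw [sv_eq_zero_of_rows_le Z (not_lt.1 hc)] at hp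
      exact absurd hp (not_lt.2 hγ)
    have hZV : Z * V = U * rectDiag m n (sv Z) := by
      conv_lhs => rw [hZ.eq_mul]
      rw [Matrix.mul_assoc, hVV, Matrix.mul_one]
    have hcol : Z *ᵥ V.col p = sv Z p • U.col ⟨p, hpm⟩ := by
      funext i
      have : (Z *ᵥ V.col p) i = (Z * V) i p := rfl
      rw [this, hZV, mul_rectDiag_apply]
      simp [hpm, mul_comm]
    rw [hcol, Matrix.mulVec_smul, hspan ⟨p, hpm⟩ hp]
  refine ext_of_mulVec_col hQZ.right_orthogonal fun j => ?_
  have hv := hQZ.gram_mulVec_col j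
  set v := V'.col j
  set t := sv (Qᵀ * Z) j with htdef
  have ht : 0 ≤ t := sv_nonneg _ _
  rw [← Matrix.mulVec_mulVec, hQZ.gsvt_mulVec_of_coord hs0 (hQZ.coord_eq_zero_or ht hv),
    Matrix.mulVec_smul, Matrix.mulVec_mulVec, ← Matrix.mul_assoc, ← Matrix.mulVec_mulVec]
  -- Above the threshold the two Gram matrices have the same eigenvectors.
  have htop (p : Fin n) (hp : γ < sv Z p) : (Vᵀ *ᵥ v) p = 0 ∨ sv Z p = t := by
    have h1 : ((Qᵀ * Z)ᵀ * (Qᵀ * Z)) *ᵥ V.col p = sv Z p ^ 2 • V.col p := by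
      rw [← hZ.gram_mulVec_col p, ← Matrix.mulVec_mulVec (V.col p) Zᵀ Z, ← hfix p hp]
      simp only [Matrix.transpose_mul, Matrix.transpose_transpose, Matrix.mulVec_mulVec,
        Matrix.mul_assoc]
    have h2 : V.col p ⬝ᵥ (((Qᵀ * Z)ᵀ * (Qᵀ * Z)) *ᵥ v) =
        (((Qᵀ * Z)ᵀ * (Qᵀ * Z)) *ᵥ V.col p) ⬝ᵥ v := by
      rw [← dotProduct_mulVec_gram, dotProduct_comm, dotProduct_mulVec_gram, dotProduct_comm]
    rw [hv, h1, dotProduct_smul, smul_dotProduct, smul_eq_mul, smul_eq_mul] at h2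
    by_cases h0 : (Vᵀ *ᵥ v) p = 0
    · exact Or.inl h0
    · exact Or.inr ((pow_left_inj₀ (sv_nonneg _ _) ht two_ne_zero).1 (mul_right_cancel₀ h0 h2.symm))
  rcases le_or_gt t γ with htγ | htγ
  · -- Both sides vanish: `v` has no component above the threshold.
    rw [hs t ht htγ, zero_div, zero_smul, ← Matrix.mulVec_mulVec, ← Matrix.mulVec_mulVec]
    have : rectDiag m n (fun i => s (sv Z i)) *ᵥ (Vᵀ *ᵥ v) = 0 := by
      funext i
      rw [rectDiag_mulVec_apply]
      split_ifs with hi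
      · rcases le_or_gt (sv Z i) γ with h | h
        · rw [hs _ (sv_nonneg _ _) h, zero_mul, Pi.zero_apply]
        · rcases htop ⟨i, hi⟩ h with h' | h'
          · rw [h', mul_zero, Pi.zero_apply]
          · exact absurd (h'.symm ▸ htγ) (not_le.2 h)
      · rfl
    rw [this, Matrix.mulVec_zero]
  · -- Compression does not increase norms, so `v` has no component below the threshold.
    have hbot (p : Fin n) (hp : sv Z p ≤ γ) : (Vᵀ *ᵥ v) p = 0 := by
      have h1 : t ^ 2 * (v ⬝ᵥ v) ≤ ∑ i : Fin n, sv Z i ^ 2 * (Vᵀ *ᵥ v) i ^ 2 := by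
        rw [← hZ.gram_quadratic, ← smul_eq_mul, ← dotProduct_smul, ← hv, ← dotProduct_mulVec_gram,
          ← Matrix.mulVec_mulVec]
        exact dotProduct_transpose_mulVec_le hQ _
      rw [← dotProduct_mulVec_of_orthogonal hZ.right_orthogonal, dotProduct, Finset.mul_sum] at h1
      have hterm (i : Fin n) (_ : i ∈ Finset.univ) : sv Z i ^ 2 * (Vᵀ *ᵥ v) i ^ 2 ≤
          t ^ 2 * ((Vᵀ *ᵥ v) i * (Vᵀ *ᵥ v) i) := by
        rw [← pow_two]
        rcases le_or_gt (sv Z i) γ with h | h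
        · exact mul_le_mul_of_nonneg_right
            (pow_le_pow_left₀ (sv_nonneg _ _) (h.trans htγ.le) 2) (sq_nonneg _)
        · rcases htop i h with h' | h' <;> simp [h']
      have heq := (Finset.sum_eq_sum_iff_of_le hterm).1
        (le_antisymm (Finset.sum_le_sum hterm) h1) p (Finset.mem_univ _)
      have hlt : sv Z p ^ 2 < t ^ 2 :=
        pow_lt_pow_left₀ (hp.trans_lt htγ) (sv_nonneg _ _) two_ne_zero
      have : (t ^ 2 - sv Z p ^ 2) * ((Vᵀ *ᵥ v) p * (Vᵀ *ᵥ v) p) = 0 := by linarith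
      simpa [(sub_pos.2 hlt).ne'] using this
    have hcoord (p : Fin n) : (Vᵀ *ᵥ v) p = 0 ∨ sv Z p = t :=
      (le_or_gt (sv Z p) γ).elim (fun h => Or.inl (hbot p h)) (htop p)
    rw [hZ.gsvt_mulVec_of_coord hs0 hcoord]
    congr 1
    have hexp : Z *ᵥ v = ∑ p, (Vᵀ *ᵥ v) p • (Z *ᵥ V.col p) := by
      conv_lhs => rw [← Matrix.one_mulVec v, ← hVV', ← Matrix.mulVec_mulVec, Matrix.mulVec_mulVec]
      funext i
      simp only [Matrix.mulVec, dotProduct, Finset.sum_apply, Pi.smul_apply, smul_eq_mul,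
        Matrix.mul_apply, Matrix.col_apply]
      exact Finset.sum_congr rfl fun p _ => mul_comm _ _
    rw [hexp, Matrix.mulVec_sum]
    refine Finset.sum_congr rfl fun p _ => ?_
    rw [Matrix.mulVec_smul]
    rcases le_or_gt (sv Z p) γ with h | h
    · rw [hbot p h, zero_smul, zero_smul]
    · rw [hfix p h]

/-! ### The range of a minimizer -/

/-- The singular values above `γ` come first. -/
lemma lt_sv_iff_lt_card (Z : Matrix (Fin m) (Fin n) ℝ) (γ : ℝ) {i : ℕ} (hi : i < m) :
    γ < sv Z i ↔ i < ((Finset.range m).filter fun i => γ < sv Z i).card := by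
  constructor
  · intro h
    have hsub : Finset.range (i + 1) ⊆ (Finset.range m).filter fun i => γ < sv Z i := by
      intro j hj
      have hj' := Finset.mem_range.1 hj
      exact Finset.mem_filter.2
        ⟨Finset.mem_range.2 (by omega), h.trans_le (sv_antitone Z (by omega))⟩
    simpa using Finset.card_le_card hsub
  · intro h
    by_contra hc
    have hsub : ((Finset.range m).filter fun i => γ < sv Z i) ⊆ Finset.range i := by
      intro j hj
      by_contra hj'
      exact hc ((Finset.mem_filter.1 hj).2.trans_le
        (sv_antitone Z (not_lt.1 (mt Finset.mem_range.2 hj'))))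
    have := Finset.card_le_card hsub
    rw [Finset.card_range] at this
    omega

/-- Every minimizer has its column space in the span of the left singular vectors with singular
values above the threshold, hence in the range of `Q`. -/
lemma mul_transpose_mul_eq_of_mem_prox {μ : ℝ} {rhat s : ℝ → ℝ}
    (hs : ∀ σ, 0 ≤ σ → s σ ∈ scalarProx μ rhat σ) {γ : ℝ} (hγ : 0 ≤ γ)
    (hthr : ∀ σ, 0 ≤ σ → σ ≤ γ → ∀ y ∈ scalarProx μ rhat σ, y = 0)
    {Z : Matrix (Fin m) (Fin n) ℝ} {U : Matrix (Fin m) (Fin m) ℝ} {V : Matrix (Fin n) (Fin n) ℝ}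
    (hZ : IsSVD Z U V) {Q : Matrix (Fin m) (Fin k) ℝ}
    (hspan : ∀ j : Fin m, γ < sv Z j → (Q * Qᵀ) *ᵥ U.col j = U.col j)
    {W : Matrix (Fin m) (Fin n) ℝ} (hW : W ∈ prox μ rhat Z) : Q * (Qᵀ * W) = W := by
  have hs0 : s 0 = 0 := hthr 0 le_rfl hγ _ (hs 0 le_rfl)
  obtain ⟨hmem, htr⟩ := sv_mem_scalarProx_of_mem_prox hs hs0 hW
  set r := ((Finset.range m).filter fun i => γ < sv Z i).card with hr
  have hrm : r ≤ m := by simpa using Finset.card_filter_le (Finset.range m) fun i => γ < sv Z i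
  have hle (i : ℕ) (hi : r ≤ i) : sv Z i ≤ γ := by
    rcases le_or_gt m i with h | h
    · rwa [sv_eq_zero_of_rows_le Z h]
    · exact not_lt.1 fun hc => not_lt.2 hi ((lt_sv_iff_lt_card Z γ h).1 hc)
  have hUU : U * Uᵀ = 1 := (Matrix.mem_orthogonalGroup_iff _ _).1 hZ.left_orthogonal
  have hzero (j : Fin m) (hj : r ≤ j) (q : Fin n) : (Uᵀ * W) j q = 0 := by
    refine transpose_mul_eq_zero_of_trace_eq hZ (fun i hi => ?_) (fun i j hi hj => ?_) htr hj q
    · rcases le_or_gt m i with h | h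
      · exact sv_eq_zero_of_rows_le W h
      · exact hthr _ (sv_nonneg _ _) (hle i hi) _ (hmem i h)
    · exact (hle j hj).trans_lt ((lt_sv_iff_lt_card Z γ (hi.trans_le hrm)).2 hi)
  have hW' : W = U * (Uᵀ * W) := by rw [← Matrix.mul_assoc, hUU, Matrix.one_mul]
  conv_rhs => rw [hW']
  rw [← Matrix.mul_assoc]
  conv_lhs => rw [hW', ← Matrix.mul_assoc]
  ext i q
  rw [Matrix.mul_apply, Matrix.mul_apply]
  refine Finset.sum_congr rfl fun j _ => ?_
  rcases le_or_gt r j with h | h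
  · rw [hzero j h q, mul_zero, mul_zero]
  · exact congrArg (· * _) (congr_fun (hspan j ((lt_sv_iff_lt_card Z γ j.2).2 h)) i)

end LowRankProx

theorem mainTheorem2 {m n k khat : ℕ} (rhat : ℝ → ℝ) (hr : LowRankProx.IsAdmissible rhat)
    (μ : ℝ) (hμ : 0 < μ) (γ : ℝ) (hγ : 0 ≤ γ)
    (Z : Matrix (Fin m) (Fin n) ℝ)
    (U : Matrix (Fin m) (Fin m) ℝ) (V : Matrix (Fin n) (Fin n) ℝ)
    (hZ : LowRankProx.IsSVD Z U V)
    (hkhat : khat = ((Finset.range m).filter (fun i => γ < LowRankProx.sv Z i)).card)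
    (Q : Matrix (Fin m) (Fin k) ℝ) (hk : khat ≤ k) (hQ : Qᵀ * Q = 1)
    (hspan : Submodule.span ℝ (U.col '' {i | (i : ℕ) < khat}) ≤
      Submodule.span ℝ (Set.range Q.col)) :
    -- the proximal operator as the set of all minimizers
    ((∀ σ : ℝ, 0 ≤ σ → σ ≤ γ → ∀ y ∈ LowRankProx.scalarProx μ rhat σ, y = 0) →
      LowRankProx.prox μ rhat Z =
        (fun Y : Matrix (Fin k) (Fin n) ℝ => Q * Y) '' LowRankProx.prox μ rhat (Qᵀ * Z)) ∧
    -- the proximal operator as a single-valued map, for a fixed rule `s` of choosing a solution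
    -- of the scalar problem
    (∀ s : ℝ → ℝ, (∀ σ : ℝ, 0 ≤ σ → s σ ∈ LowRankProx.scalarProx μ rhat σ) →
      (∀ σ : ℝ, 0 ≤ σ → σ ≤ γ → s σ = 0) →
      ∃ Y : Matrix (Fin k) (Fin n) ℝ,
        LowRankProx.gsvt s (Qᵀ * Z) = {Y} ∧ LowRankProx.gsvt s Z = {Q * Y} ∧
        Y ∈ LowRankProx.prox μ rhat (Qᵀ * Z) ∧ Q * Y ∈ LowRankProx.prox μ rhat Z) := by
  open LowRankProx in
  have hspan' (j : Fin m) (hj : γ < sv Z j) : (Q * Qᵀ) *ᵥ U.col j = U.col j := by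
    refine mul_transpose_mulVec_of_mem_span hQ (hspan (Submodule.subset_span ⟨j, ?_, rfl⟩))
    rw [Set.mem_ofPred_eq, hkhat]
    exact (lt_sv_iff_lt_card Z γ j.2).1 hj
  open LowRankProx in
  refine ⟨fun hthr => ?_, fun s hs hs0 => ?_⟩
  · -- Some choice of scalar minimizers gives a matrix minimizer, so the minimum is attained.
    have hne (σ : ℝ) : ∃ y, 0 ≤ σ → y ∈ scalarProx μ rhat σ := by
      by_cases hσ : 0 ≤ σ
      · exact (scalarProx_nonempty hr hμ hσ).imp fun y hy _ => hy
      · exact ⟨0, fun h => absurd h hσ⟩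
    choose s hs using hne
    have hfix {W : Matrix (Fin m) (Fin n) ℝ} (hW : W ∈ prox μ rhat Z) : Q * (Qᵀ * W) = W :=
      mul_transpose_mul_eq_of_mem_prox hs hγ hthr hZ hspan' hW
    have hobj := matrixObj_mul_of_orthonormal (μ := μ) hr.zero hQ Z
    refine Set.Subset.antisymm (fun W hW => ⟨Qᵀ * W, mem_prox_iff.2 fun Y => ?_, hfix hW⟩) ?_
    · have h := mem_prox_iff.1 hW (Q * Y)
      rw [← hfix hW, hobj, hobj] at h
      linarith
    · rintro _ ⟨Y, hY, rfl⟩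
      have hW₀ := gsvt_subset_prox hs (hthr 0 le_rfl hγ _ (hs 0 le_rfl)) Z ⟨U, V, hZ, rfl⟩
      refine mem_prox_iff.2 fun W => ?_
      refine le_trans ?_ (mem_prox_iff.1 hW₀ W)
      rw [← hfix hW₀, hobj, hobj]
      linarith [mem_prox_iff.1 hY (Qᵀ * (U * rectDiag m n (fun i => s (sv Z i)) * Vᵀ))]
  · have hs00 : s 0 = 0 := hs0 0 le_rfl hγ
    obtain ⟨U', V', hQZ⟩ := exists_isSVD (Qᵀ * Z)
    have heq := mul_gsvt_compress_eq hZ hQ hQZ hγ hs0 hspan'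
    refine ⟨_, gsvt_eq_singleton hQZ hs00, ?_, gsvt_subset_prox hs hs00 _ ⟨U', V', hQZ, rfl⟩, ?_⟩
    · rw [heq]
      exact gsvt_eq_singleton hZ hs00
    · rw [heq]
      exact gsvt_subset_prox hs hs00 _ ⟨U, V, hZ, rfl⟩
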